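/- Let $(\Omega,d)$ be a compact metric space with a minimal continuous real flow $(t,\omega)\mapsto\omega\cdot t$ (the only nonempty compact invariant subset is $\Omega$). Let $X=C((-\infty,0],\mathbb R^m)$ carry the compact-open topology, where $\mathbb R^m$ has the maximum norm $\|\cdot\|$. Let $BC\subset X$ be the set of bounded functions, with $\|x\|_\infty=\sup_{s\le 0}\|x(s)\|$, let $BU\subset BC$ be the set of bounded uniformly continuous functions, and let $B_r=\{x\in BC:\|x\|_\infty\le r\}$. Let $F:\Omega\times BC\to\mathbb R^m$ satisfy: (F1) $F$ is continuous when $BC$ carries the norm $\|\cdot\|_\infty$, and for each $r>0$ there is $L_r\ge 0$ with $\|F(\omega,x)-F(\omega,y)\|\le L_r\|x-y\|_\infty$ for all $\omega\in\Omega$ and $x,y\in B_r$; (F3) for each $r>0$, the restriction $F:\Omega\times B_r\to\mathbb R^m$ is continuous when $B_r$ carries the compact-open topology. For $(\omega,x)\in\Omega\times BC$ let $z(\cdot,\omega,x)$ be the maximal solution of $z'(t)=F(\omega\cdot t,z_t)$, $t\ge 0$, with $z(s,\omega,x)=x(s)$ for $s\le 0$, where $z_t(s)=z(t+s)$ for $s\le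 0$. Put $u(t,\omega,x)=z_t(\omega,x)$ and $\tau_t(\omega,x)=(\omega\cdot t,u(t,\omega,x))$ whenever the solution exists up to time $t\geq 0$. Let $(\omega_0,x_0)\in\Omega\times BC$ and suppose that $z(\cdot,\omega_0,x_0)$ is bounded on its interval of existence. Then it is defined for all $t\ge 0$, and the omega-limit set $$\mathcal O(\omega_0,x_0)=\{(\omega,x)\in\Omega\times X \mid \exists\, t_n\uparrow\infty \text{ with } \omega_0\cdot t_n\to\omega \text{ and } u(t_n,\omega_0,x_0)\to x \text{ in } X\}$$ is a nonempty compact subset of $\Omega\times X$ (product topology), is contained in $\Omega\times BU$, and there is a $K\geq 0$ such that $x$ is Lipschitz with constant $K$ for every $(\omega,x)\in\mathcal O(\omega_0,x_0)$. For every $(\omega,x)\in\mathcal O(\omega_0,x_0)$ the solution $z(\cdot,\omega,x)$ is defined for all $t\ge 0$; the set is invariant, that is, $\tau_t(\mathcal O(\omega_0,x_0))=\mathcal O(\omega_0,x_0)$ for all $t\ge 0$; and it admits a flow extension: there is a continuous real flow on $\mathcal O(\omega_0,x_0)$ (with the topology induced from $\Omega\times X$) whose time-$t$ map is the restriction of $\tau_t$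 for each $t\ge 0$. -/

import Mathlib

open Set Filter Topology

namespace InfiniteDelay

/-- The flow `σ` on the compact space `Ω` is minimal: the only nonempty compact
`σ`-invariant subset is `Ω` itself. -/
def IsMinimalFlow {Ω : Type*} [TopologicalSpace Ω] (σ : Flow ℝ Ω) : Prop :=
  ∀ K : Set Ω, K.Nonempty → IsCompact K → (∀ t : ℝ, σ t '' K = K) → K = univ

/-- `X = C((-∞,0], ℝ^m)`. The topology is Mathlib's compact-open topology, that is, uniform
convergence on compact subsets; `Fin m → ℝ` carries the maximum norm. -/
abbrev X (m : ℕ) : Type := C(Iic (0 : ℝ), Fin m → ℝ)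

/-- `BC`, the bounded elements of `X`, as a Banach space with the supremum norm. -/
abbrev BC (m : ℕ) : Type := BoundedContinuousFunction (Iic (0 : ℝ)) (Fin m → ℝ)

/-- `BU`, the bounded and uniformly continuous elements of `X`. -/
def BU (m : ℕ) : Set (X m) :=
  {x | Bornology.IsBounded (range x) ∧ UniformContinuous x}

variable {m : ℕ} {Ω : Type*} [MetricSpace Ω]

/-- (F1): `F` is continuous on `Ω × BC` for the supremum norm on `BC`, and for each `r > 0` it is
Lipschitz on `B_r` in the second variable, with a constant that does not depend on the point
of `Ω`. -/
def ConditionF1 (F : Ω → BC m → Fin m → ℝ) : Prop :=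
  Continuous (fun p : Ω × BC m => F p.1 p.2) ∧
    ∀ r : ℝ, 0 < r → ∃ L : NNReal, ∀ ω : Ω,
      LipschitzOnWith L (F ω) (Metric.closedBall (0 : BC m) r)

/-- (F3): for each `r > 0`, `F` is (sequentially) continuous on `Ω × B_r` when `B_r` carries the
compact-open topology. -/
def ConditionF3 (F : Ω → BC m → Fin m → ℝ) : Prop :=
  ∀ r : ℝ, 0 < r → ∀ (ωs : ℕ → Ω) (ω : Ω) (xs : ℕ → BC m) (x : BC m),
    (∀ n, ‖xs n‖ ≤ r) → ‖x‖ ≤ r →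
    Tendsto ωs atTop (𝓝 ω) →
    Tendsto (fun n => ((xs n).toContinuousMap : X m)) atTop (𝓝 x.toContinuousMap) →
    Tendsto (fun n => F (ωs n) (xs n)) atTop (𝓝 (F ω x))

/-- `y = z_t`, that is, `y(s) = z(t + s)` for `s ≤ 0`. -/
def IsSegment (z : ℝ → Fin m → ℝ) (t : ℝ) (y : Iic (0 : ℝ) → Fin m → ℝ) : Prop :=
  ∀ s : Iic (0 : ℝ), y s = z (t + s)

/-- `z` is, on `(-∞, T]`, a solution of `z'(t) = F(ω·t, z_t)`, `0 ≤ t ≤ T`, with initial value `x`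
on `(-∞,0]`. Derivatives at the ends of `[0,T]` are one-sided; the values of `z` beyond `T` play
no role. The segments `z_t` have to lie in `BC`, so that `x` is necessarily bounded
if `0 ≤ T`. -/
structure IsSolution (σ : Flow ℝ Ω) (F : Ω → BC m → Fin m → ℝ) (ω : Ω) (x : X m) (T : ℝ)
    (z : ℝ → Fin m → ℝ) : Prop where
  continuousOn : ContinuousOn z (Iic T)
  initial : ∀ s : Iic (0 : ℝ), z s = x s
  hasDeriv : ∀ t ∈ Icc (0 : ℝ) T, ∃ y : BC m, IsSegment z t y ∧
    HasDerivWithinAt z (F (σ t ω) y) (Icc 0 T) t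

/-- `(t, ω, x)` belongs to the domain `𝒰` of the local semiflow: `t ≥ 0` and the solution starting
from `(ω, x)` exists up to time `t`. -/
def InDomain (σ : Flow ℝ Ω) (F : Ω → BC m → Fin m → ℝ) (t : ℝ) (ω : Ω) (x : X m) : Prop :=
  0 ≤ t ∧ ∃ z, IsSolution σ F ω x t z

open Classical in
/-- `u(t, ω, x) = z_t(ω, x)`, where `z(·, ω, x)` is the solution with initial value `x`; the
value outside of the domain `InDomain` is immaterial. -/
noncomputable def u (σ : Flow ℝ Ω) (F : Ω → BC m → Fin m → ℝ) (t : ℝ) (ω : Ω) (x : X m) : X m :=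
  if h : ∃ y : X m, 0 ≤ t ∧ ∃ z, IsSolution σ F ω x t z ∧ IsSegment z t y then h.choose else x

/-- The local skew-product semiflow `τ_t(ω, x) = (ω·t, u(t, ω, x))`. -/
noncomputable def skewProduct (σ : Flow ℝ Ω) (F : Ω → BC m → Fin m → ℝ) (t : ℝ)
    (p : Ω × X m) : Ω × X m :=
  (σ t p.1, u σ F t p.1 p.2)

/-- The solution starting from `(ω, x)` is bounded on its whole interval of existence. -/
def HasBoundedSolution (σ : Flow ℝ Ω) (F : Ω → BC m → Fin m → ℝ) (ω : Ω) (x : X m) : Prop :=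
  ∃ r : ℝ, ∀ t : ℝ, InDomain σ F t ω x → ∀ s : Iic (0 : ℝ), ‖u σ F t ω x s‖ ≤ r

/-- The omega-limit set: all `(ω, x)` such that `ω₀·tₙ → ω` and `u(tₙ, ω₀, x₀) → x`, uniformly on
compact sets, for some sequence `tₙ ↑ ∞`. -/
def omegaLimitSet (σ : Flow ℝ Ω) (F : Ω → BC m → Fin m → ℝ) (ω₀ : Ω) (x₀ : X m) :
    Set (Ω × X m) :=
  {p | ∃ ts : ℕ → ℝ, Monotone ts ∧ Tendsto ts atTop atTop ∧
    Tendsto (fun n => σ (ts n) ω₀) atTop (𝓝 p.1) ∧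
    Tendsto (fun n => u σ F (ts n) ω₀ x₀) atTop (𝓝 p.2)}

/-- The restriction of `φ_t`, `t ≥ 0`, to `M` extends to a continuous real flow on `M`. -/
def AdmitsFlowExtension {E : Type*} [TopologicalSpace E] (φ : ℝ → E → E) (M : Set E) : Prop :=
  ∃ Φ : Flow ℝ M, ∀ t : ℝ, 0 ≤ t → ∀ p : M, (Φ t p : E) = φ t p

end InfiniteDelay

/-! The idea is to replace segments on the half-line by trajectories on the whole line, where time
translation is a genuine flow. Truncating segments at radius `R` makes the equation globally
solvable (`exists_solvesFrom`), and a bounded solution never feels a large enough truncation, so it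
is global (`HasBoundedSolution.exists_global`). This solution `z` is bounded, and Lipschitz on `[0,
∞)` because `F` is bounded on `Ω × B_R`; by Arzelà–Ascoli its forward translates are relatively
compact in `C(ℝ, ℝ^m)`. Hence the omega-limit set `hull` of `(ω₀, z)` under base flow times
translation is nonempty, compact and invariant. By (F3) and dominated convergence its elements are
entire solutions (`SolvesFrom.of_mem_hull`). Restriction to `(-∞, 0]` maps `hull` onto the
omega-limit set (`omegaLimitSet_eq`), intertwines translation with the semiflow, and is injective by
forward uniqueness. Being a homeomorphism by compactness, it transports the translation flow. -/

namespace InfiniteDelay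

open MeasureTheory intervalIntegral

variable {m : ℕ} {Ω : Type*} [MetricSpace Ω]

/-! ### Truncated segments -/

/-- Coordinatewise truncation of vectors to the ball of radius `R`. -/
noncomputable def clamp (R : ℝ) (v : Fin m → ℝ) : Fin m → ℝ := fun i => max (-R) (min R (v i))

lemma continuous_clamp (R : ℝ) : Continuous (clamp (m := m) R) := by
  unfold clamp; fun_prop

lemma norm_clamp_le {R : ℝ} (hR : 0 ≤ R) (v : Fin m → ℝ) : ‖clamp R v‖ ≤ R := by
  refine (pi_norm_le_iff_of_nonneg hR).2 fun i => ?_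
  rw [Real.norm_eq_abs, abs_le]
  exact ⟨le_max_left _ _, max_le (by linarith) (min_le_left _ _)⟩

lemma clamp_eq_self {R : ℝ} {v : Fin m → ℝ} (hv : ‖v‖ ≤ R) : clamp R v = v := by
  funext i
  have h := abs_le.1 ((Real.norm_eq_abs _).symm.le.trans ((norm_le_pi_norm v i).trans hv))
  simp only [clamp]
  rw [min_eq_right h.2, max_eq_right h.1]

lemma norm_clamp_sub_le (R : ℝ) (v w : Fin m → ℝ) : ‖clamp R v - clamp R w‖ ≤ ‖v - w‖ := by
  refine (pi_norm_le_iff_of_nonneg (norm_nonneg _)).2 fun i => ?_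
  have h := norm_le_pi_norm (v - w) i
  refine le_trans ?_ h
  simp only [Real.norm_eq_abs, Pi.sub_apply, clamp]
  refine (abs_max_sub_max_le_abs _ _ (-R)).trans' (by simp only [max_comm (-R)]; exact le_rfl)
    |>.trans ?_
  simpa [min_comm R] using abs_min_sub_min_le_max (v i) R (w i) R

/-- The segment at time `t` of a function on the line, truncated to the ball of radius `R`. -/
noncomputable def history {R : ℝ} (hR : 0 ≤ R) (z : C(ℝ, Fin m → ℝ)) (t : ℝ) : BC m :=
  BoundedContinuousFunction.ofNormedAddCommGroup (fun s : Iic (0 : ℝ) => clamp R (z (t + s)))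
    ((continuous_clamp R).comp (by fun_prop)) R fun _ => norm_clamp_le hR _

lemma history_apply {R : ℝ} (hR : 0 ≤ R) (z : C(ℝ, Fin m → ℝ)) (t : ℝ) (s : Iic (0 : ℝ)) :
    history hR z t s = clamp R (z (t + s)) := rfl

lemma norm_history_le {R : ℝ} (hR : 0 ≤ R) (z : C(ℝ, Fin m → ℝ)) (t : ℝ) :
    ‖history hR z t‖ ≤ R :=
  (BoundedContinuousFunction.norm_le hR).2 fun _ => norm_clamp_le hR _

lemma isSegment_history {R : ℝ} (hR : 0 ≤ R) {z : C(ℝ, Fin m → ℝ)} {t : ℝ}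
    (hz : ∀ s ≤ t, ‖z s‖ ≤ R) : IsSegment z t (history hR z t) := fun s =>
  clamp_eq_self (hz _ (by have := s.2; simp only [mem_Iic] at this; linarith))

/-- Restriction of functions on the line to the negative half-line. -/
def restrictNeg (z : C(ℝ, Fin m → ℝ)) : X m := z.comp ⟨fun s : Iic (0 : ℝ) => (s : ℝ), by fun_prop⟩

lemma continuous_restrictNeg : Continuous (restrictNeg (m := m)) :=
  ContinuousMap.continuous_precomp _

lemma continuous_toContinuousMap_history {R : ℝ} (hR : 0 ≤ R) :
    Continuous fun p : C(ℝ, Fin m → ℝ) × ℝ => ((history hR p.1 p.2).toContinuousMap : X m) := by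
  refine ContinuousMap.continuous_of_continuous_uncurry _ ?_
  refine (continuous_clamp R).comp
    (f := fun q : (C(ℝ, Fin m → ℝ) × ℝ) × Iic (0 : ℝ) => q.1.1 (q.1.2 + q.2)) ?_
  fun_prop

/-- Translation of functions on the line. -/
def shift (t : ℝ) (z : C(ℝ, Fin m → ℝ)) : C(ℝ, Fin m → ℝ) := z.comp ⟨fun s => t + s, by fun_prop⟩

@[simp] lemma shift_apply (t : ℝ) (z : C(ℝ, Fin m → ℝ)) (s : ℝ) : shift t z s = z (t + s) := rfl

lemma history_shift {R : ℝ} (hR : 0 ≤ R) (z : C(ℝ, Fin m → ℝ)) (t s : ℝ) :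
    history hR (shift t z) s = history hR z (t + s) := by
  ext1 r
  simp [history_apply, add_assoc]

variable {σ : Flow ℝ Ω} {F : Ω → BC m → Fin m → ℝ}

/-- Truncation keeps every segment in `B_R`, so (F3) applies to arbitrary `z`; sequences suffice
because the product is a sequential space. -/
lemma ConditionF3.continuous_history (hF3 : ConditionF3 F) {R : ℝ} (hR : 0 < R) :
    Continuous fun p : Ω × C(ℝ, Fin m → ℝ) × ℝ => F p.1 (history hR.le p.2.1 p.2.2) := by
  refine continuous_iff_seqContinuous.2 fun ps p hp => ?_
  refine hF3 R hR _ _ _ _ (fun n => norm_history_le _ _ _) (norm_history_le _ _ _)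
    (continuous_fst.continuousAt.tendsto.comp hp) ?_
  exact ((continuous_toContinuousMap_history hR.le).comp continuous_snd).continuousAt.tendsto.comp hp

lemma ConditionF3.continuous_field (hF3 : ConditionF3 F) {R : ℝ} (hR : 0 < R) (ω : Ω)
    (z : C(ℝ, Fin m → ℝ)) : Continuous fun s => F (σ s ω) (history hR.le z s) :=
  (hF3.continuous_history hR).comp
    ((σ.continuous continuous_id continuous_const).prodMk (continuous_const.prodMk continuous_id))

lemma ConditionF1.exists_bound [CompactSpace Ω] (hF1 : ConditionF1 F) {R : ℝ} (hR : 0 < R) :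
    ∃ M : NNReal, ∀ ω : Ω, ∀ x : BC m, ‖x‖ ≤ R → ‖F ω x‖ ≤ M := by
  obtain ⟨L, hL⟩ := hF1.2 R hR
  have hc : Continuous fun ω : Ω => F ω 0 := hF1.1.comp (continuous_id.prodMk continuous_const)
  obtain ⟨C, hC⟩ := isCompact_univ.exists_bound_of_continuousOn hc.continuousOn
  refine ⟨(L * R + |C|).toNNReal, fun ω x hx => ?_⟩
  have h := (hL ω).norm_sub_le (mem_closedBall_zero_iff.2 hx) (Metric.mem_closedBall_self hR.le)
  have h1 := hC ω (mem_univ _)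
  have h2 : ‖F ω x‖ ≤ ‖F ω x - F ω 0‖ + ‖F ω 0‖ := by
    simpa using norm_add_le (F ω x - F ω 0) (F ω 0)
  rw [sub_zero] at h
  have h3 : (L : ℝ) * ‖x‖ ≤ L * R := by gcongr
  rw [Real.coe_toNNReal _ (by positivity)]
  linarith [le_abs_self C]

/-! ### The truncated integral equation and uniqueness -/

/-- `z` solves on `[a, ∞)` the integral equation truncated at radius `R`. -/
def SolvesFrom (σ : Flow ℝ Ω) (F : Ω → BC m → Fin m → ℝ) {R : ℝ} (hR : 0 ≤ R) (ω : Ω)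
    (z : C(ℝ, Fin m → ℝ)) (a : ℝ) : Prop :=
  ∀ b c, a ≤ b → b ≤ c → z c - z b = ∫ s in b..c, F (σ s ω) (history hR z s)

lemma SolvesFrom.hasDerivWithinAt (hF3 : ConditionF3 F) {R : ℝ} (hR : 0 < R) {ω : Ω}
    {z : C(ℝ, Fin m → ℝ)} {a t : ℝ} (h : SolvesFrom σ F hR.le ω z a) (ht : a ≤ t) :
    HasDerivWithinAt z (F (σ t ω) (history hR.le z t)) (Ici a) t := by
  have hc := hF3.continuous_field (σ := σ) hR ω z
  have h1 := ((integral_hasDerivAt_right (hc.intervalIntegrable a t)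
    (hc.stronglyMeasurableAtFilter _ _) hc.continuousAt).const_add (z a)).hasDerivWithinAt (s := Ici a)
  refine h1.congr (fun s hs => ?_) ?_
  · rw [← h a s le_rfl hs]; abel
  · rw [← h a t le_rfl ht]; abel

lemma SolvesFrom.isSolution (hF3 : ConditionF3 F) {R : ℝ} (hR : 0 < R) {ω : Ω}
    {z : C(ℝ, Fin m → ℝ)} (h : SolvesFrom σ F hR.le ω z 0) {T : ℝ} (hz : ∀ s ≤ T, ‖z s‖ ≤ R)
    {x : X m} (hx : ∀ s : Iic (0 : ℝ), z s = x s) :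
    IsSolution σ F ω x T z where
  continuousOn := z.continuous.continuousOn
  initial := hx
  hasDeriv t ht := ⟨history hR.le z t, isSegment_history hR.le fun s hs => hz s (hs.trans ht.2),
    (h.hasDerivWithinAt hF3 hR ht.1).mono Icc_subset_Ici_self⟩

lemma IsSegment.norm_apply_le {z : ℝ → Fin m → ℝ} {t : ℝ} {y : BC m} (h : IsSegment z t y)
    {s : ℝ} (hs : s ≤ t) : ‖z s‖ ≤ ‖y‖ := by
  have := y.norm_coe_le_norm ⟨s - t, by simp only [mem_Iic]; linarith⟩
  rw [h] at this
  simpa using this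

/-- Solutions are unique. -/
lemma IsSolution.eqOn (hF1 : ConditionF1 F) {ω : Ω} {x : X m} {T : ℝ} (hT : 0 ≤ T)
    {z w : ℝ → Fin m → ℝ} (hz : IsSolution σ F ω x T z) (hw : IsSolution σ F ω x T w) :
    EqOn z w (Iic T) := by
  obtain ⟨y, hy, -⟩ := hz.hasDeriv T ⟨hT, le_rfl⟩
  obtain ⟨y', hy', -⟩ := hw.hasDeriv T ⟨hT, le_rfl⟩
  set r := ‖y‖ + ‖y'‖ + 1
  have hr : 0 < r := by positivity
  obtain ⟨L, hL⟩ := hF1.2 r hr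
  have hneg : ∀ s ≤ 0, z s = w s := fun s hs => by
    rw [hz.initial ⟨s, hs⟩, hw.initial ⟨s, hs⟩]
  have hcont : ContinuousOn (fun s => z s - w s) (Icc 0 T) :=
    (hz.continuousOn.sub hw.continuousOn).mono Icc_subset_Iic_self
  -- The right-hand side sees the whole past, so the weighted maximum `A` is used: it bounds the
  -- difference of segments at time `t` by `A * exp (l * t)`. As `L ≤ l / 2`, integration gives the
  -- bound `A / 2 * exp (l * t)`, which at `t₀` reads `A ≤ A / 2`.
  set l : ℝ := 2 * L + 1
  have hl : 0 < l := by positivity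
  obtain ⟨t₀, ht₀, hmax⟩ := isCompact_Icc.exists_isMaxOn (nonempty_Icc.2 hT)
    ((Continuous.continuousOn (f := fun s : ℝ => Real.exp (-(l * s))) (by fun_prop)).mul hcont.norm)
  set A := Real.exp (-(l * t₀)) * ‖z t₀ - w t₀‖
  have hA0 : 0 ≤ A := by positivity
  have hA : ∀ s ≤ T, ‖z s - w s‖ ≤ A * Real.exp (l * s) := by
    intro s hs
    rcases le_total s 0 with h0 | h0
    · rw [hneg s h0, sub_self, norm_zero]; positivity
    · have h1 : Real.exp (-(l * s)) * ‖z s - w s‖ ≤ A := hmax ⟨h0, hs⟩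
      calc ‖z s - w s‖ = (Real.exp (-(l * s)) * ‖z s - w s‖) * Real.exp (l * s) := by
            rw [mul_right_comm, ← Real.exp_add]; simp
        _ ≤ _ := by gcongr
  choose! Y hY hY' using hz.hasDeriv
  choose! W hW hW' using hw.hasDeriv
  have hball : ∀ (v : BC m) (c : ℝ), (0 ≤ c) → (∀ s, ‖v s‖ ≤ c) → ‖v‖ ≤ c := fun v c h0 h =>
    (BoundedContinuousFunction.norm_le h0).2 h
  have hsle : ∀ (t : ℝ) (s : Iic (0 : ℝ)), t + s ≤ t := fun t s => by
    have := s.2; simp only [mem_Iic] at this; linarith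
  have key := image_norm_le_of_norm_deriv_right_le_deriv_boundary (a := 0) (b := T)
    (f := fun s => z s - w s) (f' := fun s => F (σ s ω) (Y s) - F (σ s ω) (W s))
    (B := fun s => A / 2 * Real.exp (l * s)) (B' := fun s => A / 2 * (Real.exp (l * s) * l))
    hcont ?_ ?_ ?_ ?_ ht₀
  · have h2 : A ≤ A / 2 := by
      calc A ≤ Real.exp (-(l * t₀)) * (A / 2 * Real.exp (l * t₀)) := by
            simp only [A]; gcongr
        _ = A / 2 := by rw [mul_left_comm, ← Real.exp_add]; simp
    have hA' : A = 0 := by linarith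
    intro s hs
    have := hA s hs
    rw [hA', zero_mul] at this
    exact sub_eq_zero.1 (norm_le_zero_iff.1 this)
  · intro t ht
    have hmem : Icc 0 T ∈ 𝓝[Ici t] t := by
      filter_upwards [Icc_mem_nhdsGE ht.2] with s hs using ⟨ht.1.trans hs.1, hs.2⟩
    have ht' := Ico_subset_Icc_self ht
    exact ((hY' t ht').sub (hW' t ht')).mono_of_mem_nhdsWithin hmem
  · simp only [hneg 0 le_rfl, sub_self, norm_zero]; positivity
  · intro t
    have := ((hasDerivAt_id t).const_mul l).exp.const_mul (A / 2)
    simpa using this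
  · intro t ht
    have ht' := Ico_subset_Icc_self ht
    have h1 : ‖Y t‖ ≤ r := hball _ _ hr.le fun s => by
      rw [hY t ht' s]
      linarith [hy.norm_apply_le ((hsle t s).trans ht'.2), norm_nonneg y']
    have h2 : ‖W t‖ ≤ r := hball _ _ hr.le fun s => by
      rw [hW t ht' s]
      linarith [hy'.norm_apply_le ((hsle t s).trans ht'.2), norm_nonneg y]
    have h3 : ‖Y t - W t‖ ≤ A * Real.exp (l * t) := hball _ _ (by positivity) fun s => by
      rw [BoundedContinuousFunction.coe_sub, Pi.sub_apply, hY t ht' s, hW t ht' s]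
      refine (hA _ ((hsle t s).trans ht'.2)).trans ?_
      gcongr
      exact hsle t s
    have h4 := (hL (σ t ω)).norm_sub_le (mem_closedBall_zero_iff.2 h1) (mem_closedBall_zero_iff.2 h2)
    have h5 : (L : ℝ) * ‖Y t - W t‖ ≤ L * (A * Real.exp (l * t)) := by gcongr
    have h6 : 0 ≤ A * Real.exp (l * t) := by positivity
    simp only [l] at *
    nlinarith

/-- The semiflow is given by any solution. -/
lemma IsSolution.u_apply (hF1 : ConditionF1 F) {ω : Ω} {x : X m} {t : ℝ} (ht : 0 ≤ t)
    {z : ℝ → Fin m → ℝ} (hz : IsSolution σ F ω x t z) (s : Iic (0 : ℝ)) :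
    u σ F t ω x s = z (t + s) := by
  obtain ⟨y, hy, -⟩ := hz.hasDeriv t ⟨ht, le_rfl⟩
  have h : ∃ y : X m, 0 ≤ t ∧ ∃ z, IsSolution σ F ω x t z ∧ IsSegment z t y :=
    ⟨y.toContinuousMap, ht, z, hz, hy⟩
  rw [u, dif_pos h]
  obtain ⟨-, w, hw, hseg⟩ := h.choose_spec
  rw [hseg s]
  exact hw.eqOn hF1 ht hz (by have := s.2; simp only [mem_Iic] at this ⊢; linarith)

lemma IsSolution.u_eq (hF1 : ConditionF1 F) {ω : Ω} {x : X m} {t : ℝ} (ht : 0 ≤ t)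
    {z : C(ℝ, Fin m → ℝ)} (hz : IsSolution σ F ω x t z) :
    u σ F t ω x = restrictNeg (shift t z) :=
  ContinuousMap.ext fun s => hz.u_apply hF1 ht s

/-! ### Global existence for the truncated equation -/

/-- Extension of an initial value `x` by the exponentially weighted function `v`. -/
noncomputable def weightedExtension (l : ℝ) (x : BC m) (v : BoundedContinuousFunction ℝ (Fin m → ℝ)) :
    C(ℝ, Fin m → ℝ) where
  -- This is `exp (l * t) • v t` for `t ≥ 0` and `x t - x 0 + v 0` for `t ≤ 0`: continuous for every
  -- `v`, and an extension of `x` once `v 0 = x 0`, which holds at the fixed point.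
  toFun t := x ⟨min t 0, mem_Iic.2 (min_le_right _ _)⟩ - x ⟨0, self_mem_Iic⟩ +
    Real.exp (l * max t 0) • v (max t 0)
  continuous_toFun := by
    have h : Continuous fun t : ℝ => (⟨min t 0, mem_Iic.2 (min_le_right _ _)⟩ : Iic (0 : ℝ)) :=
      Continuous.subtype_mk (by fun_prop) _
    fun_prop

/-- The terms in `x` cancel, truncation is nonexpansive, and the weight is nondecreasing, so its
value at `t` dominates the past. -/
lemma norm_history_weightedExtension_sub_le {R : ℝ} (hR : 0 ≤ R) {l : ℝ} (hl : 0 ≤ l) (x : BC m)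
    (v w : BoundedContinuousFunction ℝ (Fin m → ℝ)) {t : ℝ} (ht : 0 ≤ t) :
    ‖history hR (weightedExtension l x v) t - history hR (weightedExtension l x w) t‖ ≤
      Real.exp (l * t) * ‖v - w‖ := by
  refine (BoundedContinuousFunction.norm_le (by positivity)).2 fun s => ?_
  refine (norm_clamp_sub_le R _ _).trans ?_
  simp only [weightedExtension, ContinuousMap.coe_mk, add_sub_add_left_eq_sub, ← smul_sub,
    norm_smul, Real.norm_eq_abs, Real.abs_exp]
  have hs := s.2
  simp only [mem_Iic] at hs
  have h1 : max (t + s) 0 ≤ t := max_le (by linarith) ht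
  gcongr
  exact (v - w).norm_coe_le_norm _

/-- The solution operator of the truncated equation, on exponentially weighted functions. -/
noncomputable def picardMap (σ : Flow ℝ Ω) (hF3 : ConditionF3 F) {R : ℝ} (hR : 0 < R) {M : NNReal}
    (hM : ∀ ω : Ω, ∀ x : BC m, ‖x‖ ≤ R → ‖F ω x‖ ≤ M) {l : ℝ} (hl : 1 ≤ l) (ω : Ω) (x : BC m)
    (v : BoundedContinuousFunction ℝ (Fin m → ℝ)) : BoundedContinuousFunction ℝ (Fin m → ℝ) :=
  BoundedContinuousFunction.ofNormedAddCommGroup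
    (fun t => Real.exp (-(l * max t 0)) • (x ⟨0, self_mem_Iic⟩ +
      ∫ s in (0 : ℝ)..max t 0, F (σ s ω) (history hR.le (weightedExtension l x v) s)))
    (by
      have hc := hF3.continuous_field (σ := σ) hR ω (weightedExtension l x v)
      have h1 : Continuous fun t : ℝ => ∫ s in (0 : ℝ)..t,
          F (σ s ω) (history hR.le (weightedExtension l x v) s) :=
        continuous_primitive (fun a b => hc.intervalIntegrable a b) 0
      have h2 : Continuous fun t : ℝ => max t 0 := by fun_prop
      have h3 := h1.comp h2
      simp only [Function.comp_def] at h3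
      exact Continuous.smul (f := fun t : ℝ => Real.exp (-(l * max t 0))) (by fun_prop)
        (continuous_const.add h3))
    -- The integral is at most `M * T`, and `exp (-(l * T)) * T ≤ 1` because `l ≥ 1`.
    (‖x‖ + M)
    (fun t => by
      have h0 : 0 ≤ max t 0 := le_max_right _ _
      set T := max t 0
      have h1 : ‖∫ s in (0 : ℝ)..T, F (σ s ω) (history hR.le (weightedExtension l x v) s)‖
          ≤ M * |T - 0| :=
        norm_integral_le_of_norm_le_const fun s _ => hM _ _ (norm_history_le _ _ _)
      rw [sub_zero, abs_of_nonneg h0] at h1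
      rw [norm_smul, Real.norm_eq_abs, Real.abs_exp]
      have h2 : Real.exp (-(l * T)) ≤ 1 := Real.exp_le_one_iff.2 (by nlinarith)
      have h3 : Real.exp (-(l * T)) * T ≤ 1 := by
        have h4 : T ≤ Real.exp (l * T) := by nlinarith [Real.add_one_le_exp (l * T)]
        calc Real.exp (-(l * T)) * T ≤ Real.exp (-(l * T)) * Real.exp (l * T) := by gcongr
          _ = 1 := by rw [← Real.exp_add]; simp
      have h5 := x.norm_coe_le_norm ⟨0, self_mem_Iic⟩
      calc _ ≤ Real.exp (-(l * T)) * (‖x‖ + M * T) := by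
            gcongr; exact (norm_add_le _ _).trans (add_le_add h5 h1)
        _ = Real.exp (-(l * T)) * ‖x‖ + M * (Real.exp (-(l * T)) * T) := by ring
        _ ≤ 1 * ‖x‖ + M * 1 := by gcongr
        _ = _ := by ring)

/-- Integrating `L * exp (l * s)` yields at most `exp (l * T) / 2` when `2 * L ≤ l`, and the outer
weight removes the exponential. -/
lemma norm_picardMap_sub_le (hF3 : ConditionF3 F) {R : ℝ} (hR : 0 < R) {M L : NNReal}
    (hM : ∀ ω : Ω, ∀ x : BC m, ‖x‖ ≤ R → ‖F ω x‖ ≤ M)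
    (hL : ∀ ω : Ω, LipschitzOnWith L (F ω) (Metric.closedBall (0 : BC m) R)) {l : ℝ}
    (hl : 1 ≤ l) (hlL : 2 * L ≤ l) (ω : Ω) (x : BC m)
    (v w : BoundedContinuousFunction ℝ (Fin m → ℝ)) :
    ‖picardMap σ hF3 hR hM hl ω x v - picardMap σ hF3 hR hM hl ω x w‖ ≤ 1 / 2 * ‖v - w‖ := by
  refine (BoundedContinuousFunction.norm_le (by positivity)).2 fun t => ?_
  have h0 : 0 ≤ max t 0 := le_max_right _ _
  have hc := hF3.continuous_field (σ := σ) hR ω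
  simp only [picardMap, BoundedContinuousFunction.coe_sub, Pi.sub_apply,
    BoundedContinuousFunction.coe_ofNormedAddCommGroup, ← smul_sub, add_sub_add_left_eq_sub,
    norm_smul, Real.norm_eq_abs, Real.abs_exp]
  set T := max t 0
  rw [← integral_sub ((hc _).intervalIntegrable _ _) ((hc _).intervalIntegrable _ _)]
  have hprim : ∀ s : ℝ, HasDerivAt (fun s => Real.exp (l * s) * (‖v - w‖ / 2))
      (l / 2 * (Real.exp (l * s) * ‖v - w‖)) s := fun s => by
    have := (((hasDerivAt_id s).const_mul l).exp).mul_const (‖v - w‖ / 2)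
    exact this.congr_deriv (by simp only [id]; ring)
  have h1 : ‖∫ s in (0 : ℝ)..T, (F (σ s ω) (history hR.le (weightedExtension l x v) s) -
      F (σ s ω) (history hR.le (weightedExtension l x w) s))‖ ≤
      ∫ s in (0 : ℝ)..T, l / 2 * (Real.exp (l * s) * ‖v - w‖) := by
    refine norm_integral_le_of_norm_le h0 (ae_of_all _ fun s hs => ?_)
      (Continuous.intervalIntegrable (by fun_prop) _ _)
    refine ((hL _).norm_sub_le (mem_closedBall_zero_iff.2 (norm_history_le _ _ _))
      (mem_closedBall_zero_iff.2 (norm_history_le _ _ _))).trans ?_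
    have h2 := norm_history_weightedExtension_sub_le hR.le (by linarith : 0 ≤ l) x v w hs.1.le
    gcongr
    linarith
  rw [integral_eq_sub_of_hasDerivAt (fun s _ => hprim s)
    (Continuous.intervalIntegrable (by fun_prop) _ _)] at h1
  have h3 : 0 ≤ ‖v - w‖ := norm_nonneg _
  calc _ ≤ Real.exp (-(l * T)) * (Real.exp (l * T) * (‖v - w‖ / 2)) := by
        gcongr
        refine h1.trans (sub_le_self _ (by positivity))
    _ = 1 / 2 * ‖v - w‖ := by rw [← mul_assoc, ← Real.exp_add]; simp; ring

/-- The truncated equation has global solutions. -/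
lemma exists_solvesFrom [CompactSpace Ω] (hF1 : ConditionF1 F) (hF3 : ConditionF3 F) {R : ℝ}
    (hR : 0 < R) (ω : Ω) (x : BC m) :
    ∃ z : C(ℝ, Fin m → ℝ), (∀ s : Iic (0 : ℝ), z s = x s) ∧ SolvesFrom σ F hR.le ω z 0 := by
  obtain ⟨M, hM⟩ := hF1.exists_bound hR
  obtain ⟨L, hL⟩ := hF1.2 R hR
  obtain ⟨l, hl, hlL⟩ : ∃ l : ℝ, 1 ≤ l ∧ 2 * (L : ℝ) ≤ l :=
    ⟨2 * L + 1, by linarith [L.coe_nonneg], by linarith⟩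
  have hctr : ContractingWith (1 / 2) (picardMap σ hF3 hR hM hl ω x) := by
    refine ⟨by rw [← NNReal.coe_lt_coe]; norm_num, LipschitzWith.of_dist_le_mul fun v w => ?_⟩
    rw [dist_eq_norm, dist_eq_norm]
    simpa using norm_picardMap_sub_le hF3 hR hM hL hl hlL ω x v w
  obtain ⟨v, hv⟩ : ∃ v, picardMap σ hF3 hR hM hl ω x v = v :=
    ⟨_, hctr.fixedPoint_isFixedPt⟩
  set z := weightedExtension l x v
  have hc := hF3.continuous_field (σ := σ) hR ω z
  have hpos : ∀ t, 0 ≤ t →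
      z t = x ⟨0, self_mem_Iic⟩ + ∫ s in (0 : ℝ)..t, F (σ s ω) (history hR.le z s) := by
    intro t ht
    have h1 : v t = Real.exp (-(l * t)) • (x ⟨0, self_mem_Iic⟩ +
        ∫ s in (0 : ℝ)..t, F (σ s ω) (history hR.le z s)) := by
      conv_lhs => rw [← hv]
      simp [picardMap, max_eq_left ht, z]
    have h2 : z t = Real.exp (l * t) • v t := by
      simp [z, weightedExtension, max_eq_left ht, min_eq_right ht]
    rw [h2, h1, smul_smul, ← Real.exp_add]
    simp
  refine ⟨z, fun s => ?_, fun b c hb hbc => ?_⟩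
  · have hs := s.2
    simp only [mem_Iic] at hs
    have h0 : v 0 = x ⟨0, self_mem_Iic⟩ := by
      conv_lhs => rw [← hv]
      simp [picardMap]
    simp [z, weightedExtension, max_eq_right hs, min_eq_left hs, h0]
  · rw [hpos b hb, hpos c (hb.trans hbc), add_sub_add_left_eq_sub,
      integral_interval_sub_left (hc.intervalIntegrable _ _) (hc.intervalIntegrable _ _)]

/-! ### Bounded solutions are global -/

/-- A solution that is bounded on its interval of existence is global. -/
lemma HasBoundedSolution.exists_global [CompactSpace Ω] (hF1 : ConditionF1 F)
    (hF3 : ConditionF3 F) {ω : Ω} {x : BC m}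
    (h : HasBoundedSolution σ F ω x.toContinuousMap) :
    ∃ (R : ℝ) (hR : 0 < R) (z : C(ℝ, Fin m → ℝ)), (∀ s : Iic (0 : ℝ), z s = x s) ∧
      SolvesFrom σ F hR.le ω z 0 ∧ ∀ s, ‖z s‖ ≤ R := by
  obtain ⟨r, hr⟩ := h
  set R := |r| + ‖x‖ + 1
  have hR : 0 < R := by positivity
  obtain ⟨z, hzx, hz⟩ := exists_solvesFrom (σ := σ) hF1 hF3 hR ω x
  refine ⟨R, hR, z, hzx, hz, ?_⟩
  by_contra! hcon
  obtain ⟨t, ht⟩ := hcon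
  have hneg : ∀ s ≤ 0, ‖z s‖ < R := fun s hs => by
    rw [hzx ⟨s, hs⟩]
    linarith [x.norm_coe_le_norm ⟨s, hs⟩, abs_nonneg r]
  have ht0 : 0 ≤ t := by
    by_contra! h0
    exact (hneg t h0.le).not_gt ht
  have hcpt : IsCompact (Icc 0 t ∩ {s | R ≤ ‖z s‖}) :=
    isCompact_Icc.inter_right (isClosed_le continuous_const z.continuous.norm)
  -- `T` is the first time the norm reaches `R`. Up to `T` the truncation is inactive, so `z` is a
  -- true solution and `‖z T‖ ≤ r < R`, a contradiction.
  obtain ⟨T, ⟨hT, hTR⟩, hleast⟩ := hcpt.exists_isLeast ⟨t, ⟨ht0, le_rfl⟩, ht.le⟩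
  have hlt : Iio T ⊆ {s | ‖z s‖ ≤ R} := fun s hs => by
    rcases le_total s 0 with h0 | h0
    · exact (hneg s h0).le
    · by_contra hsR
      have hsR' : R ≤ ‖z s‖ := (not_le.1 hsR).le
      exact (hleast ⟨⟨h0, hs.le.trans hT.2⟩, hsR'⟩).not_gt hs
  have hle : Iic T ⊆ {s | ‖z s‖ ≤ R} := by
    rw [← closure_Iio]
    exact closure_minimal hlt (isClosed_le z.continuous.norm continuous_const)
  have hsol := hz.isSolution hF3 hR (fun s hs => hle hs) (x := x.toContinuousMap) hzx
  have := hr T ⟨hT.1, z, hsol⟩ ⟨0, self_mem_Iic⟩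
  rw [hsol.u_apply hF1 hT.1] at this
  simp only [add_zero] at this
  have hTR' : R ≤ ‖z T‖ := hTR
  linarith [le_abs_self r, norm_nonneg x]

/-! ### Compactness of translates and the hull -/

/-- The product of the flow on the base with the translation flow. -/
def translationFlow (m : ℕ) (σ : Flow ℝ Ω) : Flow ℝ (Ω × C(ℝ, Fin m → ℝ)) where
  toFun t p := (σ t p.1, shift t p.2)
  cont' := by
    refine Continuous.prodMk (σ.continuous continuous_fst (continuous_fst.comp continuous_snd)) ?_
    refine ContinuousMap.continuous_of_continuous_uncurry _ ?_
    change Continuous fun q : (ℝ × Ω × C(ℝ, Fin m → ℝ)) × ℝ => q.1.2.2 (q.1.1 + q.2)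
    fun_prop
  map_add' t₁ t₂ p := by
    refine Prod.ext (σ.map_add _ _ _) (ContinuousMap.ext fun s => ?_)
    simp only [shift_apply]
    congr 1
    ring
  map_zero' p := Prod.ext (σ.map_zero_apply _) (ContinuousMap.ext fun s => by simp)

/-- The forward translates of a bounded function that is Lipschitz on `[0, ∞)` are relatively
compact. -/
lemma isCompact_closure_shift {R : ℝ} {M : NNReal} {z : C(ℝ, Fin m → ℝ)} (hz : ∀ s, ‖z s‖ ≤ R)
    (hM : LipschitzOnWith M z (Ici 0)) :
    IsCompact (closure ((fun t => shift t z) '' Ici (0 : ℝ))) := by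
  have : T2Space (UniformOnFun ℝ (Fin m → ℝ) {K | IsCompact K}) :=
    UniformOnFun.t2Space_of_covering
      (eq_univ_of_forall fun x => mem_sUnion_of_mem (mem_singleton x) isCompact_singleton)
  refine ArzelaAscoli.isCompact_closure_of_isClosedEmbedding (𝔖 := {K : Set ℝ | IsCompact K})
    (F := fun f : C(ℝ, Fin m → ℝ) => (f : ℝ → Fin m → ℝ)) (fun K hK => hK)
    (ContinuousMap.isUniformEmbedding_toUniformOnFunIsCompact.isClosedEmbedding) ?_ ?_
  · intro K _
    refine Equicontinuous.equicontinuousOn (fun a => ?_) K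
    -- Within distance 1 of `a`, forward translates only sample `z` on `[a - 1, ∞)`, so one modulus
    -- of continuity there serves them all. Points closer than `1 / 2` are both at most 1 or both
    -- nonnegative.
    have huc : UniformContinuousOn z (Ici (a - 1)) := by
      have h1 : UniformContinuousOn z (Icc (a - 1) 1) :=
        isCompact_Icc.uniformContinuousOn_of_continuous z.continuous.continuousOn
      have h2 := hM.uniformContinuousOn
      rw [Metric.uniformContinuousOn_iff] at h1 h2 ⊢
      intro ε hε
      obtain ⟨δ, hδ, h1⟩ := h1 ε hε
      obtain ⟨δ', hδ', h2⟩ := h2 ε hε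
      refine ⟨min (min δ δ') (1 / 2), by positivity, fun s hs t ht hst => ?_⟩
      have h3 := (lt_min_iff.1 (lt_min_iff.1 hst).1)
      have h4 := abs_lt.1 ((Real.dist_eq s t).symm.le.trans_lt (lt_min_iff.1 hst).2)
      by_cases h : s ≤ 1 ∧ t ≤ 1
      · exact h1 s ⟨hs, h.1⟩ t ⟨ht, h.2⟩ h3.1
      · have h5 : 0 ≤ s ∧ 0 ≤ t := by
          rw [not_and_or, not_le, not_le] at h
          rcases h with h | h <;> constructor <;> linarith [h4.1, h4.2]
        exact h2 s h5.1 t h5.2 h3.2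
    rw [Metric.equicontinuousAt_iff]
    intro ε hε
    obtain ⟨δ, hδ, h⟩ := Metric.uniformContinuousOn_iff.1 huc ε hε
    refine ⟨min δ 1, by positivity, ?_⟩
    rintro s hs ⟨_, t, ht, rfl⟩
    have ht' : 0 ≤ t := ht
    have h3 := lt_min_iff.1 hs
    have h4 := abs_lt.1 ((Real.dist_eq s a).symm.le.trans_lt h3.2)
    refine h (t + a) ?_ (t + s) ?_ ?_
    · simp only [mem_Ici]; linarith
    · simp only [mem_Ici]; linarith [h4.1]
    · rw [dist_add_left, dist_comm]; exact h3.1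
  · intro K _ x _
    refine ⟨Metric.closedBall 0 R, isCompact_closedBall _ _, ?_⟩
    rintro _ ⟨t, -, rfl⟩
    exact mem_closedBall_zero_iff.2 (hz _)

/-- The omega-limit set of `(ω, z)` under translation. -/
def hull (σ : Flow ℝ Ω) (ω : Ω) (z : C(ℝ, Fin m → ℝ)) : Set (Ω × C(ℝ, Fin m → ℝ)) :=
  omegaLimit atTop (translationFlow m σ) {(ω, z)}

lemma image_hull (ω : Ω) (z : C(ℝ, Fin m → ℝ)) (t : ℝ) :
    translationFlow m σ t '' hull σ ω z = hull σ ω z := by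
  have h := Flow.isInvariant_omegaLimit atTop (translationFlow m σ) {(ω, z)}
    fun t => tendsto_atTop_add_const_left _ t tendsto_id
  exact (Flow.isInvariant_iff_image_eq _ _).1 h t

lemma isCompact_nonempty_hull [CompactSpace Ω] (ω : Ω) {z : C(ℝ, Fin m → ℝ)}
    (hz : IsCompact (closure ((fun t => shift t z) '' Ici (0 : ℝ)))) :
    IsCompact (hull σ ω z) ∧ (hull σ ω z).Nonempty := by
  have hsub : closure (image2 (translationFlow m σ) (Ici 0) {(ω, z)}) ⊆
      univ ×ˢ closure ((fun t => shift t z) '' Ici (0 : ℝ)) := by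
    refine closure_minimal ?_ (isClosed_univ.prod isClosed_closure)
    rintro _ ⟨t, ht, _, rfl, rfl⟩
    exact ⟨mem_univ _, subset_closure ⟨t, ht, rfl⟩⟩
  have hc := (isCompact_univ (X := Ω)).prod hz
  exact ⟨hc.of_isClosed_subset (isClosed_omegaLimit _ _ _)
      ((omegaLimit_subset_closure_image2 _ _ _ (Ici_mem_atTop 0)).trans hsub),
    nonempty_omegaLimit_of_isCompact_absorbing _ _ _ hc ⟨_, Ici_mem_atTop 0, hsub⟩
      (singleton_nonempty _)⟩

lemma mem_hull_iff {ω : Ω} {z : C(ℝ, Fin m → ℝ)} {p : Ω × C(ℝ, Fin m → ℝ)} :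
    p ∈ hull σ ω z ↔ ∃ ts : ℕ → ℝ, Monotone ts ∧ Tendsto ts atTop atTop ∧
      Tendsto (fun n => translationFlow m σ (ts n) (ω, z)) atTop (𝓝 p) := by
  rw [hull, mem_omegaLimit_singleton_iff_mapClusterPt]
  constructor
  · intro h
    obtain ⟨ts, hlim, hts⟩ := h.exists_seq_tendsto
    obtain ⟨φ, hφ, hmono⟩ := strictMono_subseq_of_tendsto_atTop hts
    exact ⟨ts ∘ φ, hmono.monotone, hts.comp hφ.tendsto_atTop, hlim.comp hφ.tendsto_atTop⟩
  · rintro ⟨ts, -, hts, hlim⟩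
    exact hlim.mapClusterPt.of_comp hts

/-- Limits of translates of a bounded solution are bounded solutions on the whole line. -/
lemma SolvesFrom.of_mem_hull (hF3 : ConditionF3 F) {R : ℝ} (hR : 0 < R) {M : NNReal}
    (hM : ∀ ω : Ω, ∀ x : BC m, ‖x‖ ≤ R → ‖F ω x‖ ≤ M) {ω : Ω} {z : C(ℝ, Fin m → ℝ)}
    (hz : SolvesFrom σ F hR.le ω z 0) {p : Ω × C(ℝ, Fin m → ℝ)} (hp : p ∈ hull σ ω z) (a : ℝ) :
    SolvesFrom σ F hR.le p.1 p.2 a := by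
  obtain ⟨ts, -, hts, hlim⟩ := mem_hull_iff.1 hp
  intro b c hb hbc
  have hlim1 : Tendsto (fun n => σ (ts n) ω) atTop (𝓝 p.1) := (continuous_fst.tendsto p).comp hlim
  have hlim2 : Tendsto (fun n => shift (ts n) z) atTop (𝓝 p.2) := (continuous_snd.tendsto p).comp hlim
  have hev : ∀ s, Tendsto (fun n => shift (ts n) z s) atTop (𝓝 (p.2 s)) := fun s =>
    ((continuous_eval_const s).tendsto _).comp hlim2
  have h1 : Tendsto (fun n => ∫ s in b..c, F (σ s (σ (ts n) ω)) (history hR.le (shift (ts n) z) s))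
      atTop (𝓝 (∫ s in b..c, F (σ s p.1) (history hR.le p.2 s))) := by
    refine tendsto_integral_filter_of_dominated_convergence (fun _ => (M : ℝ)) ?_ ?_ ?_ ?_
    · exact Eventually.of_forall fun n =>
        (hF3.continuous_field hR _ _).aestronglyMeasurable
    · exact Eventually.of_forall fun n => ae_of_all _ fun s _ => hM _ _ (norm_history_le _ _ _)
    · exact intervalIntegrable_const
    · refine ae_of_all _ fun s _ => ?_
      have hs : Tendsto (fun n => σ s (σ (ts n) ω)) atTop (𝓝 (σ s p.1)) :=
        ((σ.continuous continuous_const continuous_id).tendsto p.1).comp hlim1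
      exact ((hF3.continuous_history hR).tendsto (σ s p.1, p.2, s)).comp
        (hs.prodMk_nhds (hlim2.prodMk_nhds tendsto_const_nhds))
  refine tendsto_nhds_unique ((hev c).sub (hev b)) (h1.congr' ?_)
  -- The translate by `ts n` solves from `-ts n`, hence from `b` for large `n`; this is why `a` is
  -- arbitrary.
  filter_upwards [hts.eventually_ge_atTop (-b)] with n hn
  rw [shift_apply, shift_apply, hz _ _ (by linarith) (by linarith)]
  simp only [history_shift, ← Flow.map_add]
  rw [← intervalIntegral.integral_comp_add_left]
  simp only [add_comm]

lemma norm_le_of_mem_hull {R : ℝ} {ω : Ω} {z : C(ℝ, Fin m → ℝ)} (hz : ∀ s, ‖z s‖ ≤ R)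
    {p : Ω × C(ℝ, Fin m → ℝ)} (hp : p ∈ hull σ ω z) (s : ℝ) : ‖p.2 s‖ ≤ R := by
  obtain ⟨ts, -, -, hlim⟩ := mem_hull_iff.1 hp
  have hlim2 : Tendsto (fun n => shift (ts n) z) atTop (𝓝 p.2) := (continuous_snd.tendsto p).comp hlim
  exact le_of_tendsto (((continuous_eval_const s).tendsto _).comp hlim2).norm
    (Eventually.of_forall fun n => hz _)

lemma SolvesFrom.lipschitzOnWith {R : ℝ} {hR : 0 ≤ R} {M : NNReal}
    (hM : ∀ ω : Ω, ∀ x : BC m, ‖x‖ ≤ R → ‖F ω x‖ ≤ M) {ω : Ω} {z : C(ℝ, Fin m → ℝ)} {a : ℝ}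
    (hz : SolvesFrom σ F hR ω z a) : LipschitzOnWith M z (Ici a) := by
  have key : ∀ s t, a ≤ s → s ≤ t → ‖z t - z s‖ ≤ M * |t - s| := fun s t hs hst => by
    rw [hz s t hs hst]
    exact norm_integral_le_of_norm_le_const fun r _ => hM _ _ (norm_history_le _ _ _)
  refine LipschitzOnWith.of_dist_le_mul fun s hs t ht => ?_
  rcases le_total s t with h | h
  · rw [dist_comm, dist_comm s, dist_eq_norm, Real.dist_eq]; exact key s t hs h
  · rw [dist_eq_norm, Real.dist_eq]; exact key t s ht h

/-! ### From entire solutions back to segments -/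

/-- Restriction of the second component to the negative half-line. -/
def hullProj (p : Ω × C(ℝ, Fin m → ℝ)) : Ω × X m := (p.1, restrictNeg p.2)

lemma continuous_hullProj : Continuous (hullProj (m := m) (Ω := Ω)) :=
  continuous_fst.prodMk (continuous_restrictNeg.comp continuous_snd)

lemma skewProduct_hullProj (hF1 : ConditionF1 F) {p : Ω × C(ℝ, Fin m → ℝ)} {t : ℝ} (ht : 0 ≤ t)
    (h : IsSolution σ F p.1 (restrictNeg p.2) t p.2) :
    skewProduct σ F t (hullProj p) = hullProj (translationFlow m σ t p) :=
  Prod.ext rfl (h.u_eq hF1 ht)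

/-- The segment at time 0 already contains the whole past and determines the future, so no backward
uniqueness is needed. -/
lemma injOn_hullProj (hF1 : ConditionF1 F) {S : Set (Ω × C(ℝ, Fin m → ℝ))}
    (hS : ∀ p ∈ S, ∀ t, IsSolution σ F p.1 (restrictNeg p.2) t p.2) : InjOn hullProj S := by
  rintro ⟨ω, w⟩ hp ⟨ω', w'⟩ hq h
  obtain ⟨rfl, hw⟩ := Prod.ext_iff.1 h
  refine Prod.ext rfl (ContinuousMap.ext fun t => ?_)
  have h1 := hS _ hp (max t 0)
  have h2 := hS _ hq (max t 0)
  simp only [hullProj] at h1 h2 hw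
  rw [← hw] at h2
  exact h1.eqOn hF1 (le_max_right _ _) h2 (le_max_left t 0)

/-- Convergence of segments controls only nonpositive times; compactness supplies a subsequence of
translates converging on the whole line, and its limit must restrict to the given one. -/
lemma omegaLimitSet_eq [CompactSpace Ω] {ω : Ω} {x : X m} {z : C(ℝ, Fin m → ℝ)}
    (hu : ∀ t, 0 ≤ t → u σ F t ω x = restrictNeg (shift t z))
    (hz : IsCompact (closure ((fun t => shift t z) '' Ici (0 : ℝ)))) :
    omegaLimitSet σ F ω x = hullProj '' hull σ ω z := by
  ext p
  constructor
  · rintro ⟨ts, hmono, hts, h1, h2⟩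
    obtain ⟨N, hN⟩ := eventually_atTop.1 (hts.eventually_ge_atTop 0)
    obtain ⟨w, -, φ, hφ, hw⟩ := hz.tendsto_subseq
      (x := fun n => shift (ts (n + N)) z) fun n => subset_closure ⟨_, hN _ (by omega), rfl⟩
    have hψ : Tendsto (fun n => φ n + N) atTop atTop :=
      (tendsto_add_atTop_nat N).comp hφ.tendsto_atTop
    refine ⟨(p.1, w), mem_hull_iff.2 ⟨fun n => ts (φ n + N), fun a b hab =>
      hmono (Nat.add_le_add_right (hφ.monotone hab) _), hts.comp hψ, ?_⟩, Prod.ext rfl ?_⟩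
    · exact (h1.comp hψ).prodMk_nhds hw
    · refine tendsto_nhds_unique ((continuous_restrictNeg.tendsto w).comp hw) ?_
      refine (h2.comp hψ).congr fun n => ?_
      exact hu _ (hN _ (Nat.le_add_left _ _))
  · rintro ⟨q, hq, rfl⟩
    obtain ⟨ts, hmono, hts, hlim⟩ := mem_hull_iff.1 hq
    refine ⟨ts, hmono, hts, (continuous_fst.tendsto q).comp hlim, ?_⟩
    refine Tendsto.congr' ?_ ((continuous_restrictNeg.tendsto q.2).comp
      ((continuous_snd.tendsto q).comp hlim))
    filter_upwards [hts.eventually_ge_atTop 0] with n hn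
    exact (hu _ hn).symm

/-- A flow on a compact invariant set is transported by continuous injective maps. -/
lemma admitsFlowExtension_image {E E' : Type*} [TopologicalSpace E] [TopologicalSpace E'] [T2Space E']
    (Φ : Flow ℝ E) {S : Set E} (hS : IsCompact S) (hinv : ∀ t, Φ t '' S = S) {π : E → E'}
    (hπ : Continuous π) (hinj : InjOn π S) {φ : ℝ → E' → E'}
    (hφ : ∀ t, 0 ≤ t → ∀ p ∈ S, φ t (π p) = π (Φ t p)) : AdmitsFlowExtension φ (π '' S) := by
  have : CompactSpace S := isCompact_iff_compactSpace.1 hS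
  have hmaps : ∀ t, ∀ p ∈ S, Φ t p ∈ S := fun t p hp => (hinv t).subset (mem_image_of_mem _ hp)
  let e : S ≃ π '' S := Equiv.Set.imageOfInjOn π S hinj
  have he : ∀ p : S, (e p : E') = π p := fun p => rfl
  have hec : Continuous e := Continuous.subtype_mk (hπ.comp continuous_subtype_val) _
  let h : S ≃ₜ π '' S := hec.homeoOfEquivCompactToT2
  have hh : ∀ p : S, (h p : E') = π p := he
  refine ⟨{ toFun := fun t q => h ⟨Φ t (h.symm q), hmaps t _ (h.symm q).2⟩
            cont' := ?_, map_add' := ?_, map_zero' := ?_ }, ?_⟩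
  · refine h.continuous.comp (Continuous.subtype_mk ?_ _)
    exact Φ.continuous continuous_fst
      (continuous_subtype_val.comp (h.symm.continuous.comp continuous_snd))
  · intro t₁ t₂ q
    simp [Flow.map_add]
  · intro q
    simp
  · intro t ht q
    change (h ⟨Φ t (h.symm q), hmaps t _ (h.symm q).2⟩ : E') = φ t q
    rw [hh, ← hφ t ht _ (h.symm q).2, ← hh, h.apply_symm_apply]

end InfiniteDelay

theorem mainTheorem8 {m : ℕ} {Ω : Type*} [MetricSpace Ω] [CompactSpace Ω]
    (σ : Flow ℝ Ω) (hσ : InfiniteDelay.IsMinimalFlow σ)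
    (F : Ω → InfiniteDelay.BC m → Fin m → ℝ)
    (hF1 : InfiniteDelay.ConditionF1 F) (hF3 : InfiniteDelay.ConditionF3 F)
    (ω₀ : Ω) (x₀ : InfiniteDelay.BC m)
    (hbdd : InfiniteDelay.HasBoundedSolution σ F ω₀ x₀.toContinuousMap) :
    (∀ t : ℝ, 0 ≤ t → InfiniteDelay.InDomain σ F t ω₀ x₀.toContinuousMap) ∧
    (InfiniteDelay.omegaLimitSet σ F ω₀ x₀.toContinuousMap).Nonempty ∧
    IsCompact (InfiniteDelay.omegaLimitSet σ F ω₀ x₀.toContinuousMap) ∧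
    InfiniteDelay.omegaLimitSet σ F ω₀ x₀.toContinuousMap ⊆ univ ×ˢ InfiniteDelay.BU m ∧
    (∃ K : NNReal, ∀ p ∈ InfiniteDelay.omegaLimitSet σ F ω₀ x₀.toContinuousMap,
      LipschitzWith K p.2) ∧
    (∀ p ∈ InfiniteDelay.omegaLimitSet σ F ω₀ x₀.toContinuousMap, ∀ t : ℝ, 0 ≤ t →
      InfiniteDelay.InDomain σ F t p.1 p.2) ∧
    (∀ t : ℝ, 0 ≤ t →
      InfiniteDelay.skewProduct σ F t '' InfiniteDelay.omegaLimitSet σ F ω₀ x₀.toContinuousMap =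
        InfiniteDelay.omegaLimitSet σ F ω₀ x₀.toContinuousMap) ∧
    InfiniteDelay.AdmitsFlowExtension (InfiniteDelay.skewProduct σ F)
      (InfiniteDelay.omegaLimitSet σ F ω₀ x₀.toContinuousMap) := by
  open InfiniteDelay in
  obtain ⟨R, hR, z, hzx, hz, hzR⟩ := hbdd.exists_global hF1 hF3
  obtain ⟨M, hM⟩ := hF1.exists_bound hR
  have hsol : ∀ t, IsSolution σ F ω₀ x₀.toContinuousMap t z := fun t =>
    hz.isSolution hF3 hR (fun s _ => hzR s) hzx
  have hcl := isCompact_closure_shift hzR (hz.lipschitzOnWith hM)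
  obtain ⟨hcpt, hne⟩ := isCompact_nonempty_hull (σ := σ) ω₀ hcl
  rw [omegaLimitSet_eq (fun t ht => (hsol t).u_eq hF1 ht) hcl]
  have hS : ∀ p ∈ hull σ ω₀ z, ∀ t, IsSolution σ F p.1 (restrictNeg p.2) t p.2 := fun p hp t =>
    (hz.of_mem_hull hF3 hR hM hp 0).isSolution hF3 hR (fun s _ => norm_le_of_mem_hull hzR hp s)
      fun s => rfl
  have hlip : ∀ p ∈ hull σ ω₀ z, LipschitzWith M (restrictNeg p.2) := fun p hp => by
    refine LipschitzWith.of_dist_le_mul fun s t => ?_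
    -- Elements of the hull solve from every starting time, so starting at `min s t` gives the same
    -- constant `M` for all pairs.
    exact (hz.of_mem_hull hF3 hR hM hp (min s t)).lipschitzOnWith hM |>.dist_le_mul _
      (min_le_left (s : ℝ) t) _ (min_le_right (s : ℝ) t)
  refine ⟨fun t ht => ⟨ht, z, hsol t⟩, hne.image _, hcpt.image continuous_hullProj, ?_, ⟨M, ?_⟩,
    ?_, fun t ht => ?_, ?_⟩
  · rintro _ ⟨p, hp, rfl⟩
    refine ⟨mem_univ _, ?_, (hlip p hp).uniformContinuous⟩
    refine isBounded_iff_forall_norm_le.2 ⟨R, ?_⟩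
    rintro _ ⟨s, rfl⟩
    exact norm_le_of_mem_hull hzR hp s
  · rintro _ ⟨p, hp, rfl⟩
    exact hlip p hp
  · rintro _ ⟨p, hp, rfl⟩ t ht
    exact ⟨ht, p.2, hS p hp t⟩
  · conv_rhs => rw [← image_hull ω₀ z t]
    rw [image_image, image_image]
    exact image_congr fun p hp => skewProduct_hullProj hF1 ht (hS p hp t)
  · exact admitsFlowExtension_image (translationFlow m σ) hcpt (image_hull ω₀ z)
      continuous_hullProj (injOn_hullProj hF1 hS) fun t ht p hp =>
        skewProduct_hullProj hF1 ht (hS p hp t)
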